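/- Let $c>0$, $\lambda>0$, let $V(0)$ be a random variable with $P\{V(0)=c\}=P\{V(0)=-c\}=\tfrac12$, and let $N=\{N(s)\}_{s\ge 0}$ be a homogeneous Poisson process with rate $\lambda$ independent of $V(0)$. Let $\mathcal T(t)=\int_0^t V(0)(-1)^{N(s)}\,ds$, $t\ge0$, be the corresponding symmetric telegraph process. Then for every $t>0$, every integer $k\ge 0$ and every $\beta$ with $0<\beta<ct$, $$P\Bigl\{\max_{0\le s\le t}\mathcal T(s)<\beta \,\Big|\, V(0)=c,\ N(t)=2k+2\Bigr\}=P\Bigl\{\max_{0\le s\le t}\mathcal T(s)<\beta \,\Big|\, V(0)=c,\ N(t)=2k+1\Bigr\}=\frac{\beta}{ct}\sum_{j=0}^{k}\binom{2j}{j}\Bigl(\frac{\sqrt{c^2t^2-\beta^2}}{2ct}\Bigr)^{2j}.$$ -/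

import Mathlib

open MeasureTheory ProbabilityTheory Set
open scoped NNReal

/-- `N` is a homogeneous Poisson process with rate `lam` on `(Ω, P)`: an integer-valued counting
process (started at `0`, with nondecreasing right-continuous paths) with independent increments,
whose increment over `(s, t]` has the Poisson law with parameter `lam * (t - s)`. -/
structure IsPoissonProcess {Ω : Type*} [MeasurableSpace Ω] (lam : ℝ≥0) (N : ℝ≥0 → Ω → ℕ)
    (P : Measure Ω) : Prop where
  measurable : ∀ t, Measurable (N t)
  zero : ∀ ω, N 0 ω = 0
  monotone : ∀ ω, Monotone (fun s => N s ω)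
  rightContinuous : ∀ ω s, ContinuousWithinAt (fun r => N r ω) (Ici s) s
  indepIncrements : HasIndepIncrements N P
  law_increment : ∀ s t, s ≤ t →
    HasLaw (fun ω => N t ω - N s ω) (poissonMeasure (lam * (t - s))) P

/-- The data of a symmetric telegraph process with speed `c` and rate `lam`: an initial velocity
`V`, equal to `c` or `-c` with probability `1/2` each, and a homogeneous Poisson process `N` with
rate `lam`, independent of `V`. -/
structure IsSymmetricTelegraph {Ω : Type*} [MeasurableSpace Ω] (c : ℝ) (lam : ℝ≥0) (V : Ω → ℝ)
    (N : ℝ≥0 → Ω → ℕ) (P : Measure Ω) : Prop where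
  measurable_velocity : Measurable V
  prob_pos : P {ω | V ω = c} = 1 / 2
  prob_neg : P {ω | V ω = -c} = 1 / 2
  poisson : IsPoissonProcess lam N P
  indep : IndepFun V (fun ω s => N s ω) P

/-- The position at time `t` of the telegraph process with initial velocity `V` and velocity
reversals at the jumps of `N`: `∫₀ᵗ V (-1)^{N(s)} ds`. -/
noncomputable def telegraph {Ω : Type*} (V : Ω → ℝ) (N : ℝ≥0 → Ω → ℕ) (t : ℝ≥0) (ω : Ω) : ℝ :=
  ∫ s in (0 : ℝ)..(t : ℝ), V ω * (-1) ^ N s.toNNReal ω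

/-- The maximum of the telegraph process over the time interval `[0, t]`. -/
noncomputable def telegraphMax {Ω : Type*} (V : Ω → ℝ) (N : ℝ≥0 → Ω → ℕ) (t : ℝ≥0) (ω : Ω) : ℝ :=
  sSup ((fun s : ℝ≥0 => telegraph V N s ω) '' Icc 0 t)

/-- Along a nondecreasing counting path the supremum in `telegraphMax` is a maximum. -/
theorem isGreatest_telegraphMax {Ω : Type*} (V : Ω → ℝ) (N : ℝ≥0 → Ω → ℕ) (t : ℝ≥0) (ω : Ω)
    (hN : Monotone (fun s => N s ω)) :
    IsGreatest ((fun s : ℝ≥0 => telegraph V N s ω) '' Icc 0 t) (telegraphMax V N t ω) := by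
  have hm : Measurable (fun s : ℝ => V ω * (-1 : ℝ) ^ N s.toNNReal ω) :=
    ((measurable_of_countable (fun n : ℕ => V ω * (-1 : ℝ) ^ n)).comp hN.measurable).comp
      measurable_real_toNNReal
  have hi : ∀ a b : ℝ, IntervalIntegrable (fun s : ℝ => V ω * (-1 : ℝ) ^ N s.toNNReal ω)
      volume a b := fun a b =>
    (intervalIntegrable_const (c := |V ω|)).mono_fun' hm.aestronglyMeasurable
      (Filter.Eventually.of_forall fun s => by simp)
  have hc : Continuous (fun s : ℝ≥0 => telegraph V N s ω) :=
    (intervalIntegral.continuous_primitive hi 0).comp NNReal.continuous_coe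
  exact (isCompact_Icc.image hc).isGreatest_sSup ((nonempty_Icc.2 (zero_le)).image _)

/-! Rescaling space by `1 / c` gives unit speed. With `F_v(n, t, x)` the probability, starting with
velocity `v = ±1`, of staying below `x` on `[0, t]` with exactly `n` reversals, times `exp (lam *
t)`, conditioning on a short first interval gives a transport equation: along the characteristic `s
↦ (t - s, x - v * s)`, `F_v(n + 1)` has derivative `-lam * F_{-v}(n)`. The boundary data are `F_1 =
0` at level `0`, and `F_{-1} = (lam * t) ^ n / n!` at `x = t`, where the barrier is out of reach.

In the coordinates `p = (t + x) / 2`, `q = (t - x) / 2`, one of the two stays constant along each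
characteristic. The sums `signedDividedPowers r n p q` with `r = 0` for `v = 1` and `r = 1` for `v =
-1` solve the same system with the same boundary data, so induction on `n` yields
`scaledProb_eq_signedDividedPowers`.

Division by the Poisson weight of `n` reversals turns the sum with `r = 0` into the conditional
probability. Its closed form comes from a recursion in `n`: a step from even to odd degree adds one
central binomial term (`factorial_mul_even_succ`), a step from odd to even adds nothing
(`factorial_mul_odd_succ`). This is why `2k + 1` and `2k + 2` reversals give the same value. -/

open scoped Nat in
/-- The sum of `sign (i + r - j) * p ^ i / i! * q ^ j / j!` over `i + j = n`. -/
noncomputable def signedDividedPowers (r : ℤ) (n : ℕ) (p q : ℝ) : ℝ :=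
  ∑ ij ∈ Finset.HasAntidiagonal.antidiagonal n,
    (SignType.sign ((ij.1 : ℤ) + r - ij.2) : ℝ) * (p ^ ij.1 / ij.1 !) * (q ^ ij.2 / ij.2 !)

/-! ### Derivatives, boundary values and closed form of the signed sums. -/

namespace signedDividedPowers

theorem hasDerivAt_pow_succ_div_factorial (n : ℕ) (p : ℝ) :
    HasDerivAt (fun p : ℝ => p ^ (n + 1) / (n + 1).factorial) (p ^ n / n.factorial) p := by
  convert! (hasDerivAt_pow (n + 1) p).div_const ((n + 1).factorial : ℝ) using 1
  rw [Nat.factorial_succ]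
  push_cast
  rw [mul_div_mul_left _ _ (by positivity)]

theorem hasDerivAt_fst (r : ℤ) (n : ℕ) (p q : ℝ) :
    HasDerivAt (fun p => signedDividedPowers r (n + 1) p q)
      (signedDividedPowers (r + 1) n p q) p := by
  simp only [signedDividedPowers, Finset.Nat.antidiagonal_succ, Finset.sum_cons, Finset.sum_map]
  refine HasDerivAt.congr_deriv (HasDerivAt.add (f' := 0) ?_ (HasDerivAt.fun_sum fun ij _ =>
    ((hasDerivAt_pow_succ_div_factorial ij.1 p).const_mul _).mul_const _)) ?_
  · simpa using hasDerivAt_const p _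
  · rw [zero_add]
    refine Finset.sum_congr rfl fun ij _ => ?_
    simp [add_assoc, add_comm r 1]

theorem hasDerivAt_snd (r : ℤ) (n : ℕ) (p q : ℝ) :
    HasDerivAt (fun q => signedDividedPowers r (n + 1) p q)
      (signedDividedPowers (r - 1) n p q) q := by
  simp only [signedDividedPowers, Finset.Nat.antidiagonal_succ', Finset.sum_cons, Finset.sum_map]
  refine HasDerivAt.congr_deriv (HasDerivAt.add (f' := 0) ?_ (HasDerivAt.fun_sum fun ij _ =>
    ((hasDerivAt_pow_succ_div_factorial ij.2 q).const_mul _))) ?_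
  · simpa using hasDerivAt_const q _
  · rw [zero_add]
    refine Finset.sum_congr rfl fun ij _ => ?_
    have : (ij.1 : ℤ) + r - (ij.2 + 1) = ij.1 + (r - 1) - ij.2 := by ring
    simp [this]

theorem continuous (r : ℤ) (n : ℕ) : Continuous fun x : ℝ × ℝ =>
    signedDividedPowers r n x.1 x.2 := by
  unfold signedDividedPowers
  fun_prop

theorem zero_index (r : ℤ) (p q : ℝ) :
    signedDividedPowers r 0 p q = (SignType.sign r : ℝ) := by
  simp [signedDividedPowers]

/-- Swapping `i` and `j` flips the sign of every term. This matches the zero probability at level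
`0`, where `p = q`. -/
theorem self_eq_zero (n : ℕ) (p : ℝ) : signedDividedPowers 0 n p p = 0 := by
  have h : signedDividedPowers 0 n p p = -signedDividedPowers 0 n p p := by
    conv_lhs => rw [signedDividedPowers, ← Finset.Nat.sum_antidiagonal_swap]
    rw [signedDividedPowers, ← Finset.sum_neg_distrib]
    refine Finset.sum_congr rfl fun ij _ => ?_
    have : (ij.2 : ℤ) + 0 - ij.1 = -(ij.1 + 0 - ij.2) := by ring
    simp only [Prod.fst_swap, Prod.snd_swap, this, Left.sign_neg, SignType.coe_neg]
    ring
  linarith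

theorem one_right_zero (n : ℕ) (p : ℝ) :
    signedDividedPowers 1 n p 0 = p ^ n / n.factorial := by
  rw [signedDividedPowers, Finset.sum_eq_single (n, 0)]
  · have : SignType.sign ((n : ℤ) + 1) = 1 := sign_pos (by positivity)
    simp [this]
  · rintro ⟨i, j⟩ hij hne
    have : j ≠ 0 := by
      rintro rfl
      simp at hij
      simp [hij] at hne
    simp [this]
  · simp

/-- Euler's identity for a homogeneous polynomial of degree `n + 1`, whose partial derivatives are
the sums with `r` shifted by one. It is checked termwise by splitting `n + 1 = i + j`. -/
theorem succ_mul (r : ℤ) (n : ℕ) (p q : ℝ) :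
    (n + 1) * signedDividedPowers r (n + 1) p q =
      p * signedDividedPowers (r + 1) n p q + q * signedDividedPowers (r - 1) n p q := by
  have hf : ∀ i : ℕ, ((i + 1).factorial : ℝ) = (i + 1) * i.factorial := fun i => by
    rw [Nat.factorial_succ]; push_cast; rfl
  have h1 : p * signedDividedPowers (r + 1) n p q =
      ∑ ij ∈ Finset.HasAntidiagonal.antidiagonal (n + 1), (ij.1 : ℝ) * ((SignType.sign ((ij.1 : ℤ) + r - ij.2) : ℝ) * (p ^ ij.1 / ij.1.factorial) *
        (q ^ ij.2 / ij.2.factorial)) := by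
    rw [Finset.Nat.sum_antidiagonal_succ, signedDividedPowers, Finset.mul_sum]
    simp only [Nat.cast_zero, zero_mul, zero_add]
    refine Finset.sum_congr rfl fun ij _ => ?_
    have : (ij.1 : ℤ) + (r + 1) - ij.2 = (ij.1 + 1 : ℕ) + r - ij.2 := by push_cast; ring
    simp only [this, hf]
    push_cast
    field_simp
    ring
  have h2 : q * signedDividedPowers (r - 1) n p q =
      ∑ ij ∈ Finset.HasAntidiagonal.antidiagonal (n + 1), (ij.2 : ℝ) * ((SignType.sign ((ij.1 : ℤ) + r - ij.2) : ℝ) * (p ^ ij.1 / ij.1.factorial) *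
        (q ^ ij.2 / ij.2.factorial)) := by
    rw [Finset.Nat.sum_antidiagonal_succ', signedDividedPowers, Finset.mul_sum]
    simp only [Nat.cast_zero, zero_mul, zero_add]
    refine Finset.sum_congr rfl fun ij _ => ?_
    have : (ij.1 : ℤ) + (r - 1) - ij.2 = ij.1 + r - (ij.2 + 1 : ℕ) := by push_cast; ring
    simp only [this, hf]
    push_cast
    field_simp
    ring
  rw [h1, h2, ← Finset.sum_add_distrib, signedDividedPowers, Finset.mul_sum]
  refine Finset.sum_congr rfl fun ij hij => ?_
  rw [← add_mul]
  congr 1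
  exact_mod_cast (Finset.HasAntidiagonal.mem_antidiagonal.1 hij).symm

/-- Used to return from `r = ±1` to `r = 0`: the parity of `i - j` is that of `n`, so the shift
changes the sign of only one pair. -/
theorem sub_eq_single (r s : ℤ) (n : ℕ) (p q : ℝ) (i j : ℕ) (hij : i + j = n)
    (h : ∀ i' j' : ℕ, i' + j' = n → i' ≠ i →
      SignType.sign ((i' : ℤ) + r - j') = SignType.sign ((i' : ℤ) + s - j')) :
    signedDividedPowers r n p q - signedDividedPowers s n p q =
      ((SignType.sign ((i : ℤ) + r - j) : ℝ) - (SignType.sign ((i : ℤ) + s - j) : ℝ)) *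
        (p ^ i / i.factorial) * (q ^ j / j.factorial) := by
  rw [signedDividedPowers, signedDividedPowers, ← Finset.sum_sub_distrib,
    Finset.sum_eq_single (i, j)]
  · ring
  · rintro ⟨i', j'⟩ hm hne
    rw [Finset.HasAntidiagonal.mem_antidiagonal] at hm
    simp only at hm
    rw [h i' j' hm (by rintro rfl; exact hne (by simp; omega))]
    ring
  · intro hm
    exact absurd (Finset.HasAntidiagonal.mem_antidiagonal.2 hij) hm

theorem sign_congr {a b : ℤ} (h1 : 0 < a ↔ 0 < b) (h2 : a < 0 ↔ b < 0) :
    SignType.sign a = SignType.sign b := by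
  rcases lt_trichotomy a 0 with h | h | h
  · rw [sign_neg h, sign_neg (h2.1 h)]
  · have : b = 0 := by omega
    rw [h, this]
  · rw [sign_pos h, sign_pos (h1.1 h)]

/-- In degree `2m` the affected pair is `(m, m)` for both shifts. Its two corrections have opposite
signs and weights `p` and `q`, whence the factor `p - q`. -/
theorem even_succ (m : ℕ) (p q : ℝ) :
    (2 * m + 1) * signedDividedPowers 0 (2 * m + 1) p q =
      (p + q) * signedDividedPowers 0 (2 * m) p q +
        (p - q) * (p * q) ^ m / (m.factorial * m.factorial) := by
  have h := succ_mul 0 (2 * m) p q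
  have h1 := sub_eq_single (0 + 1) 0 (2 * m) p q m m (by omega)
    fun i j _ _ => sign_congr (by omega) (by omega)
  have h2 := sub_eq_single (0 - 1) 0 (2 * m) p q m m (by omega)
    fun i j _ _ => sign_congr (by omega) (by omega)
  simp only [zero_add, zero_sub, add_zero, sub_self, sign_zero, SignType.coe_zero, sub_zero,
    add_sub_cancel_left, Left.sign_neg, sign_one, SignType.coe_neg, SignType.coe_one,
    ← sub_eq_add_neg, sub_sub_cancel_left] at h h1 h2
  rw [sub_eq_iff_eq_add.1 h1, sub_eq_iff_eq_add.1 h2] at h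
  push_cast at h
  rw [h, mul_pow]
  field_simp
  ring

/-- In degree `2m + 1` the two shifts affect the mirror pairs `(m, m + 1)` and `(m + 1, m)`;
weighted by `p` and `q`, the corrections cancel. -/
theorem odd_succ (m : ℕ) (p q : ℝ) :
    (2 * m + 2) * signedDividedPowers 0 (2 * m + 2) p q =
      (p + q) * signedDividedPowers 0 (2 * m + 1) p q := by
  have h := succ_mul 0 (2 * m + 1) p q
  have h1 := sub_eq_single (0 + 1) 0 (2 * m + 1) p q m (m + 1) (by omega)
    fun i j _ _ => sign_congr (by omega) (by omega)
  have h2 := sub_eq_single (0 - 1) 0 (2 * m + 1) p q (m + 1) m (by omega)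
    fun i j _ _ => sign_congr (by omega) (by omega)
  have e1 : (m : ℤ) + (0 + 1) - (m + 1 : ℕ) = 0 := by push_cast; ring
  have e2 : (m : ℤ) + 0 - (m + 1 : ℕ) = -1 := by push_cast; ring
  have e3 : ((m + 1 : ℕ) : ℤ) + (0 - 1) - m = 0 := by push_cast; ring
  have e4 : ((m + 1 : ℕ) : ℤ) + 0 - m = 1 := by push_cast; ring
  rw [e1, e2] at h1
  rw [e3, e4] at h2
  simp only [sign_zero, SignType.coe_zero, Left.sign_neg, sign_one, SignType.coe_neg,
    SignType.coe_one] at h1 h2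
  rw [sub_eq_iff_eq_add.1 h1, sub_eq_iff_eq_add.1 h2] at h
  push_cast at h
  rw [show (2 * (m : ℝ) + 2) = 2 * m + 1 + 1 by ring, h]
  field_simp
  ring

theorem factorial_mul_even_succ (m : ℕ) (p q : ℝ) :
    (2 * m + 1).factorial * signedDividedPowers 0 (2 * m + 1) p q =
      (p + q) * ((2 * m).factorial * signedDividedPowers 0 (2 * m) p q) +
        (2 * m).choose m * ((p - q) * (p * q) ^ m) := by
  have hc : ((2 * m).choose m : ℝ) * (m.factorial * m.factorial) = (2 * m).factorial := by
    have := Nat.choose_mul_factorial_mul_factorial (n := 2 * m) (k := m) (by omega)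
    rw [show 2 * m - m = m by omega] at this
    rw [← mul_assoc]
    exact_mod_cast this
  rw [Nat.factorial_succ]
  push_cast
  rw [mul_right_comm, even_succ, ← hc]
  field_simp

theorem factorial_mul_odd_succ (m : ℕ) (p q : ℝ) :
    (2 * m + 2).factorial * signedDividedPowers 0 (2 * m + 2) p q =
      (p + q) * ((2 * m + 1).factorial * signedDividedPowers 0 (2 * m + 1) p q) := by
  rw [Nat.factorial_succ]
  push_cast
  rw [show 2 * (m : ℝ) + 1 + 1 = 2 * m + 2 by ring, mul_right_comm, odd_succ]
  ring

theorem factorial_mul_odd (k : ℕ) (p q : ℝ) (hpq : p + q ≠ 0) :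
    (2 * k + 1).factorial * signedDividedPowers 0 (2 * k + 1) p q / (p + q) ^ (2 * k + 1) =
      (p - q) / (p + q) * ∑ j ∈ Finset.range (k + 1),
        ((2 * j).choose j : ℝ) * (p * q / (p + q) ^ 2) ^ j := by
  induction k with
  | zero =>
    have := even_succ 0 p q
    simp [zero_index] at this
    simp [this]
  | succ k ih =>
    rw [Finset.sum_range_succ, mul_add ((p - q) / (p + q)), ← ih, factorial_mul_even_succ (k + 1),
      show 2 * (k + 1) = 2 * k + 2 by ring, factorial_mul_odd_succ, div_pow, ← pow_mul,
      show 2 * (k + 1) = 2 * k + 2 by ring]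
    field_simp
    ring

theorem factorial_mul_even (k : ℕ) (p q : ℝ) (hpq : p + q ≠ 0) :
    (2 * k + 2).factorial * signedDividedPowers 0 (2 * k + 2) p q / (p + q) ^ (2 * k + 2) =
      (2 * k + 1).factorial * signedDividedPowers 0 (2 * k + 1) p q / (p + q) ^ (2 * k + 1) := by
  rw [factorial_mul_odd_succ, pow_succ _ (2 * k + 1)]
  field_simp

end signedDividedPowers

/-! ### Sample paths and restarting at a fixed time. -/

section Path

variable {Ω : Type*} {V : Ω → ℝ} {N : ℝ≥0 → Ω → ℕ} {ω : Ω}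

theorem intervalIntegrable_velocity (hN : Monotone fun s => N s ω) (a b : ℝ) :
    IntervalIntegrable (fun s : ℝ => V ω * (-1 : ℝ) ^ N s.toNNReal ω) volume a b :=
  (intervalIntegrable_const (c := |V ω|)).mono_fun'
    (((measurable_of_countable (fun n : ℕ => V ω * (-1 : ℝ) ^ n)).comp hN.measurable).comp
      measurable_real_toNNReal).aestronglyMeasurable
    (Filter.Eventually.of_forall fun s => by simp)

theorem continuous_telegraph (hN : Monotone fun s => N s ω) :
    Continuous fun s : ℝ≥0 => telegraph V N s ω :=
  (intervalIntegral.continuous_primitive (intervalIntegrable_velocity hN) 0).comp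
    NNReal.continuous_coe

@[simp]
theorem telegraph_zero : telegraph V N 0 ω = 0 := by simp [telegraph]

theorem telegraphMax_lt_iff (hN : Monotone fun s => N s ω) (t : ℝ≥0) (x : ℝ) :
    telegraphMax V N t ω < x ↔ ∀ s ≤ t, telegraph V N s ω < x := by
  have h := isGreatest_telegraphMax V N t ω hN
  constructor
  · exact fun hx s hs => (h.2 ⟨s, ⟨zero_le, hs⟩, rfl⟩).trans_lt hx
  · intro hx
    obtain ⟨s, hs, he⟩ := h.1
    rw [← he]
    exact hx s hs.2

theorem abs_telegraph_le (s : ℝ≥0) : |telegraph V N s ω| ≤ |V ω| * s := by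
  have := intervalIntegral.norm_integral_le_of_norm_le_const (a := 0) (b := (s : ℝ)) (C := |V ω|)
    (f := fun s : ℝ => V ω * (-1 : ℝ) ^ N s.toNNReal ω) (fun s _ => by simp)
  simpa [telegraph] using this

theorem telegraph_of_eq_zero (hN : Monotone fun s => N s ω) {r : ℝ≥0} (h : N r ω = 0) :
    telegraph V N r ω = V ω * r := by
  have : ∀ s ∈ uIcc (0 : ℝ) r, V ω * (-1 : ℝ) ^ N s.toNNReal ω = V ω := fun s hs => by
    rw [uIcc_of_le r.coe_nonneg] at hs
    have h1 : N s.toNNReal ω ≤ N r ω := hN (Real.toNNReal_le_iff_le_coe.2 hs.2)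
    rw [show N s.toNNReal ω = 0 by omega]
    simp
  rw [telegraph, intervalIntegral.integral_congr this]
  simp [mul_comm]

theorem telegraph_const_mul (a : ℝ) (s : ℝ≥0) :
    telegraph (fun ω => a * V ω) N s ω = a * telegraph V N s ω := by
  simp only [telegraph, mul_assoc]
  exact intervalIntegral.integral_const_mul _ _

/-- The counting process restarted at time `h`. -/
def restartAt (N : ℝ≥0 → Ω → ℕ) (h : ℝ≥0) : ℝ≥0 → Ω → ℕ := fun s ω => N (h + s) ω - N h ω

theorem restartAt_restartAt (hN : Monotone fun s => N s ω) (a b s : ℝ≥0) :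
    restartAt (restartAt N a) b s ω = restartAt N (a + b) s ω := by
  have h1 : N a ω ≤ N (a + b) ω := hN le_self_add
  simp only [restartAt, add_assoc]
  omega

theorem eval_add_eq (hN : Monotone fun s => N s ω) (h s : ℝ≥0) :
    N (h + s) ω = N h ω + restartAt N h s ω := by
  have h1 : N h ω ≤ N (h + s) ω := hN le_self_add
  simp only [restartAt]
  omega

theorem telegraph_add (hN : Monotone fun s => N s ω) (h s : ℝ≥0) :
    telegraph V N (h + s) ω =
      telegraph V N h ω + telegraph (fun ω => (-1) ^ N h ω * V ω) (restartAt N h) s ω := by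
  have e : telegraph (fun ω => (-1) ^ N h ω * V ω) (restartAt N h) s ω =
      ∫ u in (0 : ℝ)..s, V ω * (-1) ^ N (u + h).toNNReal ω := by
    refine intervalIntegral.integral_congr fun u hu => ?_
    rw [uIcc_of_le s.coe_nonneg] at hu
    have : (u + h).toNNReal = h + u.toNNReal := by
      rw [Real.toNNReal_add hu.1 h.coe_nonneg, Real.toNNReal_coe, add_comm]
    simp only
    rw [this, eval_add_eq hN, pow_add]
    ring
  rw [e, intervalIntegral.integral_comp_add_right
    (fun u : ℝ => V ω * (-1) ^ N u.toNNReal ω), zero_add, telegraph, telegraph,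
    intervalIntegral.integral_add_adjacent_intervals (intervalIntegrable_velocity hN _ _)
      (intervalIntegrable_velocity hN _ _), add_comm (s : ℝ), NNReal.coe_add]

end Path

/-! ### Measurability of the barrier event. -/

section Measurability

variable {Ω : Type*} {N : ℝ≥0 → Ω → ℕ}

theorem le_iff_exists_gt_mem_dense_le {f : ℝ≥0 → ℕ} (hf : Monotone f)
    {s : ℝ≥0} (hc : ContinuousWithinAt f (Ici s) s) (D : Set ℝ≥0) (hD : Dense D) (k : ℕ) :
    f s ≤ k ↔ ∃ r ∈ D, s < r ∧ f r ≤ k := by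
  constructor
  · intro hk
    have h1 : ∀ᶠ r in nhdsWithin s (Ici s), f r = f s := by
      have := hc (show {f s} ∈ nhds (f s) by simp)
      exact this
    have h2 : ∀ᶠ r in nhdsWithin s (Ioi s), f r = f s :=
      h1.filter_mono (nhdsWithin_mono _ Ioi_subset_Ici_self)
    obtain ⟨u, hu, hsub⟩ := (mem_nhdsGT_iff_exists_Ioo_subset).1 h2
    obtain ⟨r, hr, hrD⟩ := hD.exists_between (show s < u from hu)
    exact ⟨r, hr, hrD.1, (hsub hrD : f r = f s).le.trans hk⟩
  · rintro ⟨r, -, hr, hk⟩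
    exact (hf hr.le).trans hk

theorem measurable_uncurry_of_rightContinuous {m : MeasurableSpace Ω}
    (hm : ∀ s, Measurable (N s)) (hN : ∀ ω, Monotone fun s => N s ω)
    (hc : ∀ ω s, ContinuousWithinAt (fun r => N r ω) (Ici s) s) :
    Measurable fun x : ℝ≥0 × Ω => N x.1 x.2 := by
  obtain ⟨D, hDc, hD⟩ := TopologicalSpace.exists_countable_dense ℝ≥0
  refine measurable_of_Iic fun k => ?_
  have : (fun x : ℝ≥0 × Ω => N x.1 x.2) ⁻¹' Iic k = ⋃ r ∈ D, Iio r ×ˢ {ω | N r ω ≤ k} := by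
    ext ⟨s, ω⟩
    simp only [mem_preimage, mem_Iic, mem_iUnion, mem_prod, mem_Iio, mem_ofPred_eq, exists_prop]
    exact le_iff_exists_gt_mem_dense_le (hN ω) (hc ω s) D hD k
  rw [this]
  exact .biUnion hDc fun r _ => measurableSet_Iio.prod (hm r measurableSet_Iic)

/-- The event that the telegraph process with initial velocity `v` stays below `x` on `[0, t]`. -/
def staysBelow (v : ℝ) (N : ℝ≥0 → Ω → ℕ) (t : ℝ≥0) (x : ℝ) : Set Ω :=
  {ω | ∀ s ≤ t, telegraph (fun _ => v) N s ω < x}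

theorem measurable_telegraph_const {m : MeasurableSpace Ω} (v : ℝ)
    (hm : ∀ s, Measurable (N s)) (hN : ∀ ω, Monotone fun s => N s ω)
    (hc : ∀ ω s, ContinuousWithinAt (fun r => N r ω) (Ici s) s) (t : ℝ≥0) :
    Measurable (telegraph (fun _ => v) N t) := by
  have h : Measurable fun x : Ω × ℝ => v * (-1 : ℝ) ^ N x.2.toNNReal x.1 :=
    (measurable_of_countable fun n : ℕ => v * (-1 : ℝ) ^ n).comp
      ((measurable_uncurry_of_rightContinuous hm hN hc).comp
        ((measurable_real_toNNReal.comp measurable_snd).prodMk measurable_fst))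
  have := h.stronglyMeasurable.integral_prod_right' (ν := volume.restrict (Ioc (0 : ℝ) t))
  convert! this.measurable using 1
  ext ω
  rw [telegraph, intervalIntegral.integral_of_le t.coe_nonneg]

theorem measurableSet_staysBelow {m : MeasurableSpace Ω} (v : ℝ)
    (hm : ∀ s, Measurable (N s)) (hN : ∀ ω, Monotone fun s => N s ω)
    (hc : ∀ ω s, ContinuousWithinAt (fun r => N r ω) (Ici s) s) (t : ℝ≥0) (x : ℝ) :
    MeasurableSet (staysBelow v N t x) := by
  obtain ⟨D, hDc, hD⟩ := TopologicalSpace.exists_countable_dense ℝ≥0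
  -- The maximum is attained, so staying below `x` leaves room for a rational bound `y < x`;
  -- continuity then reduces all times to countably many, and `min s t` confines them to `[0, t]`.
  have : staysBelow v N t x =
      ⋃ y : {y : ℚ // (y : ℝ) < x}, ⋂ s ∈ D, {ω | telegraph (fun _ => v) N (min s t) ω ≤ y} := by
    ext ω
    simp only [staysBelow, mem_ofPred_eq, mem_iUnion, mem_iInter]
    rw [← telegraphMax_lt_iff (hN ω)]
    have hg := isGreatest_telegraphMax (fun _ => v) N t ω (hN ω)
    constructor
    · intro hx
      obtain ⟨y, hy1, hy2⟩ := exists_rat_btwn hx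
      exact ⟨⟨y, hy2⟩, fun s _ => (hg.2 ⟨min s t, ⟨zero_le, min_le_right _ _⟩, rfl⟩).trans hy1.le⟩
    · rintro ⟨⟨y, hy⟩, h⟩
      obtain ⟨s, hs, he⟩ := hg.1
      have hcl : IsClosed {s : ℝ≥0 | telegraph (fun _ => v) N (min s t) ω ≤ y} :=
        isClosed_le
          ((continuous_telegraph (V := fun _ => v) (hN ω)).comp (continuous_id.min continuous_const))
          continuous_const
      have hall := hcl.closure_subset_iff.2 (show D ⊆ _ from h) (hD s)
      simp only [mem_ofPred_eq, min_eq_left hs.2] at hall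
      rw [← he]
      exact hall.trans_lt hy
  rw [this]
  exact .iUnion fun y => .biInter hDc fun s _ =>
    measurable_telegraph_const v hm hN hc _ measurableSet_Iic

/-- Independence of the whole path speaks only of preimages of product-measurable sets. Running the
measurability proof in the σ-algebra generated by the path supplies such a set. -/
theorem exists_measurableSet_preimage_eq_staysBelow (v : ℝ) (hN : ∀ ω, Monotone fun s => N s ω)
    (hc : ∀ ω s, ContinuousWithinAt (fun r => N r ω) (Ici s) s) (t : ℝ≥0) (x : ℝ) (n : ℕ) :
    ∃ B : Set (ℝ≥0 → ℕ), MeasurableSet B ∧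
      (fun ω s => N s ω) ⁻¹' B = staysBelow v N t x ∩ {ω | N t ω = n} := by
  let m : MeasurableSpace Ω := MeasurableSpace.comap (fun ω s => N s ω) inferInstance
  have hm : ∀ s, Measurable (N s) := fun s =>
    (measurable_pi_apply (X := fun _ : ℝ≥0 => ℕ) s).comp
      (comap_measurable fun ω s => N s ω)
  exact (measurableSet_staysBelow v hm hN hc t x).inter (hm t (measurableSet_singleton n))

end Measurability

/-! ### Independence of the restarted Poisson process from the past count. -/

section Poisson

variable {Ω : Type*} [MeasurableSpace Ω] {P : Measure Ω} {lam : ℝ≥0} {N : ℝ≥0 → Ω → ℕ}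

theorem exists_monotone_nat_range_superset (J : Finset ℝ≥0) :
    ∃ σ : ℕ → ℝ≥0, Monotone σ ∧ ∀ j ∈ J, ∃ i < J.card, σ i = j := by
  refine ⟨fun i => if hi : i < J.card then J.orderEmbOfFin rfl ⟨i, hi⟩ else J.sup id, ?_, ?_⟩
  · intro a b hab
    by_cases hb : b < J.card
    · simp [hb, hab.trans_lt hb, hab]
    · by_cases ha : a < J.card
      · simpa [ha, hb] using Finset.le_sup (f := id) (J.orderEmbOfFin_mem rfl ⟨a, ha⟩)
      · simp [ha, hb]
  · intro j hj
    obtain ⟨i, hi⟩ := (show j ∈ range (J.orderEmbOfFin rfl) by simpa using hj)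
    exact ⟨i, i.2, by simp [hi]⟩

namespace IsPoissonProcess

theorem measurable_restartAt (hN : IsPoissonProcess lam N P) (h s : ℝ≥0) :
    Measurable (restartAt N h s) := (hN.measurable _).sub (hN.measurable _)

theorem restartAt_mono (hN : IsPoissonProcess lam N P) (h : ℝ≥0) (ω : Ω) :
    Monotone fun s => restartAt N h s ω :=
  fun _ _ hab => Nat.sub_le_sub_right (hN.monotone ω (by gcongr)) _

theorem restartAt (hN : IsPoissonProcess lam N P) (h : ℝ≥0) :
    IsPoissonProcess lam (restartAt N h) P where
  measurable := hN.measurable_restartAt h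
  zero ω := by simp [_root_.restartAt]
  monotone := hN.restartAt_mono h
  rightContinuous ω s := by
    have h1 : ContinuousWithinAt (fun r => N (h + r) ω) (Ici s) s :=
      (hN.rightContinuous ω (h + s)).comp (t := Ici (h + s)) (by fun_prop)
        fun r (hr : s ≤ r) => show h + s ≤ h + r by gcongr
    exact (continuous_of_discreteTopology
      (f := fun n : ℕ => n - N h ω)).continuousAt.comp_continuousWithinAt h1
  indepIncrements n τ hτ := by
    have := hN.indepIncrements n (fun i => h + τ i) fun a b hab => by
      have := hτ hab
      simp only
      gcongr
    convert! this using 3 with i ω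
    have h1 : N h ω ≤ N (h + τ i.castSucc) ω := hN.monotone ω le_self_add
    simp only [_root_.restartAt]
    omega
  law_increment s t hst := by
    have := hN.law_increment (h + s) (h + t) (by gcongr)
    rw [add_tsub_add_eq_tsub_left] at this
    convert! this using 2 with ω
    have h1 : N h ω ≤ N (h + s) ω := hN.monotone ω le_self_add
    simp only [_root_.restartAt]
    omega

theorem indepFun_restartAt [IsProbabilityMeasure P] (hN : IsPoissonProcess lam N P) (h : ℝ≥0) :
    IndepFun (N h) (fun ω s => _root_.restartAt N h s ω) P := by
  refine IndepFun.indepFun_process (hN.measurable h) (hN.measurable_restartAt h) fun J => ?_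
  obtain ⟨σ, hσ, hJ⟩ := exists_monotone_nat_range_superset J
  choose! idx hidx hidx' using hJ
  -- Increment `0` of this grid is `N h`, and increments `1, …, idx j + 1` telescope to the
  -- restarted count at `j`; disjoint blocks of increments are independent.
  let τ : ℕ → ℝ≥0 := fun i => Nat.casesOn i 0 fun i => Nat.casesOn i h fun i => h + σ i
  have hτ : Monotone τ := monotone_nat_of_le_succ fun i => by
    rcases i with _ | _ | i
    · exact zero_le
    · exact le_self_add
    · exact add_le_add_right (hσ i.le_succ) h
  have hi := (hN.indepIncrements.nat hτ).indepFun_finset {0} (Finset.Icc 1 J.card)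
    (by simp) fun i => (hN.measurable _).sub (hN.measurable _)
  let φ : (({0} : Finset ℕ) → ℕ) → ℕ := fun x => x ⟨0, by simp⟩
  have hmem : ∀ (j : J) (l : Finset.Icc 1 (idx j + 1)), (l : ℕ) ∈ Finset.Icc 1 J.card := by
    intro j l
    have := Finset.mem_Icc.1 l.2
    have := hidx j j.2
    simp only [Finset.mem_Icc]
    omega
  let ψ : (Finset.Icc 1 J.card → ℕ) → J → ℕ := fun x j =>
    ∑ l : Finset.Icc 1 (idx j + 1), x ⟨l, hmem j l⟩
  have hψ : Measurable ψ := measurable_pi_lambda _ fun j =>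
    Finset.measurable_sum _ fun l _ => measurable_pi_apply _
  refine (hi.comp (φ := φ) (ψ := ψ) (measurable_pi_apply _) hψ).congr ?_ ?_
  · refine Filter.Eventually.of_forall fun ω => ?_
    simp [φ, τ, hN.zero]
  · refine Filter.Eventually.of_forall fun ω => funext fun j => ?_
    simp only [Function.comp, ψ]
    rw [Finset.sum_coe_sort (Finset.Icc 1 (idx j + 1)) fun l => N (τ (l + 1)) ω - N (τ l) ω,
      ← Finset.Ico_add_one_right_eq_Icc, Finset.sum_Ico_eq_sum_range]
    have := Finset.sum_range_tsub (f := fun l => N (τ (1 + l)) ω)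
      ((hN.monotone ω).comp (hτ.comp fun a b hab => Nat.add_le_add_left hab 1))
      (idx j + 1)
    rw [Nat.add_sub_cancel]
    simp only [add_assoc] at this ⊢
    rw [this, _root_.restartAt]
    simp [τ, Nat.add_comm 1, hidx' j j.2]

theorem measureReal_inter_restartAt [IsProbabilityMeasure P] (hN : IsPoissonProcess lam N P)
    (h : ℝ≥0) (i : ℕ) (v : ℝ) (t : ℝ≥0) (x : ℝ) (n : ℕ) :
    P.real ({ω | N h ω = i} ∩
      (staysBelow v (_root_.restartAt N h) t x ∩ {ω | _root_.restartAt N h t ω = n})) =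
      P.real {ω | N h ω = i} *
        P.real (staysBelow v (_root_.restartAt N h) t x ∩ {ω | _root_.restartAt N h t ω = n}) := by
  have h1 := (hN.restartAt h)
  obtain ⟨B, hB, hBe⟩ := exists_measurableSet_preimage_eq_staysBelow v h1.monotone
    h1.rightContinuous t x n
  rw [← hBe]
  have := (hN.indepFun_restartAt h).measure_inter_preimage_eq_mul {i} B
    (measurableSet_singleton i) hB
  simp only [measureReal_def]
  rw [← ENNReal.toReal_mul]
  exact congrArg ENNReal.toReal this

end IsPoissonProcess

end Poisson

/-! ### Effect of zero or one early reversal on the barrier event. -/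

section PathInclusions

variable {Ω : Type*} {N : ℝ≥0 → Ω → ℕ} {ω : Ω} {v x : ℝ} {h u : ℝ≥0}

theorem telegraph_congr {V W : Ω → ℝ} (hVW : V ω = W ω) (s : ℝ≥0) :
    telegraph V N s ω = telegraph W N s ω := by
  simp only [telegraph, hVW]

theorem pos_of_mem_staysBelow {t : ℝ≥0} (hω : ω ∈ staysBelow v N t x) : 0 < x := by
  simpa using hω 0 zero_le

theorem telegraph_add_of_eq_zero (hN : Monotone fun s => N s ω) (h0 : N h ω = 0) (s : ℝ≥0) :
    telegraph (fun _ => v) N (h + s) ω = v * h + telegraph (fun _ => v) (restartAt N h) s ω := by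
  rw [telegraph_add hN, telegraph_of_eq_zero hN h0]
  congr 1
  exact telegraph_congr (by simp [h0]) s

theorem telegraph_add_of_eq_one (hN : Monotone fun s => N s ω) (h1 : N h ω = 1) (s : ℝ≥0) :
    telegraph (fun _ => v) N (h + s) ω =
      telegraph (fun _ => v) N h ω + telegraph (fun _ => -v) (restartAt N h) s ω := by
  rw [telegraph_add hN]
  congr 1
  exact telegraph_congr (by simp [h1]) s

theorem mem_staysBelow_restartAt_of_eq_zero (hN : Monotone fun s => N s ω) (h0 : N h ω = 0)
    (hω : ω ∈ staysBelow v N (h + u) x) : ω ∈ staysBelow v (restartAt N h) u (x - v * h) := by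
  intro s hs
  have := hω (h + s) (by gcongr)
  rw [telegraph_add_of_eq_zero hN h0] at this
  linarith

theorem mem_staysBelow_add_of_eq_zero (hN : Monotone fun s => N s ω) (h0 : N h ω = 0) (hx : 0 < x)
    (hω : ω ∈ staysBelow v (restartAt N h) u (x - v * h)) : ω ∈ staysBelow v N (h + u) x := by
  intro s hs
  rcases le_total s h with hsh | hsh
  · have h1 : N s ω ≤ N h ω := hN hsh
    rw [telegraph_of_eq_zero hN (by omega)]
    -- Time `0` of the restarted path gives `v * h < x`, which controls the straight first segment
    -- when `v` is positive; `hx` covers the other case.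
    have h2 := pos_of_mem_staysBelow hω
    rcases le_total v 0 with hv | hv
    · exact (mul_nonpos_of_nonpos_of_nonneg hv s.coe_nonneg).trans_lt hx
    · have : v * s ≤ v * h := by gcongr
      linarith
  · obtain ⟨r, rfl⟩ := exists_add_of_le hsh
    rw [telegraph_add_of_eq_zero hN h0]
    have := hω r (le_of_add_le_add_left hs)
    linarith

/-- The reversal time within `[0, h]` is unknown, so the position at `h` is known only up to `±h`.
This costs a shift of the level by `h` in each direction, harmless as `h → 0`. -/
theorem mem_staysBelow_restartAt_of_eq_one (hN : Monotone fun s => N s ω) (h1 : N h ω = 1)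
    (hv : |v| ≤ 1) (hω : ω ∈ staysBelow v N (h + u) x) :
    ω ∈ staysBelow (-v) (restartAt N h) u (x + h) := by
  intro s hs
  have h2 := hω (h + s) (by gcongr)
  rw [telegraph_add_of_eq_one hN h1] at h2
  have h3 := (abs_le.1 (abs_telegraph_le (V := fun _ => v) (N := N) (ω := ω) h)).1
  have h4 : |v| * h ≤ 1 * h := by gcongr
  linarith

theorem mem_staysBelow_add_of_eq_one (hN : Monotone fun s => N s ω) (h1 : N h ω = 1)
    (hv : |v| ≤ 1) (hω : ω ∈ staysBelow (-v) (restartAt N h) u (x - h)) :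
    ω ∈ staysBelow v N (h + u) x := by
  have hb : ∀ s ≤ h, telegraph (fun _ => v) N s ω ≤ h := fun s hs => by
    have h3 := (abs_le.1 (abs_telegraph_le (V := fun _ => v) (N := N) (ω := ω) s)).2
    have h4 : |v| * s ≤ 1 * h := by gcongr
    linarith
  intro s hs
  rcases le_total s h with hsh | hsh
  · have := hb s hsh
    have := pos_of_mem_staysBelow hω
    linarith
  · obtain ⟨r, rfl⟩ := exists_add_of_le hsh
    rw [telegraph_add_of_eq_one hN h1]
    have := hω r (le_of_add_le_add_left hs)
    have := hb h le_rfl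
    linarith

end PathInclusions

/-! ### Poisson weights and short-time bounds. -/

namespace IsPoissonProcess

variable {Ω : Type*} [MeasurableSpace Ω] {P : Measure Ω} {lam : ℝ≥0} {N : ℝ≥0 → Ω → ℕ}

theorem measureReal_eq (hN : IsPoissonProcess lam N P) (t : ℝ≥0) (n : ℕ) :
    P.real {ω | N t ω = n} = Real.exp (-(lam * t)) * (lam * t) ^ n / n.factorial := by
  have h := hN.law_increment 0 t zero_le
  simp only [hN.zero, tsub_zero] at h
  have := h.measure_eq (p := fun k => k = n) (measurableSet_singleton n)
  rw [measureReal_def, this]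
  simpa [measureReal_def] using poissonMeasure_real_singleton (lam * t) n

theorem measurableSet_eq (hN : IsPoissonProcess lam N P) (t : ℝ≥0) (n : ℕ) :
    MeasurableSet {ω | N t ω = n} := hN.measurable t (measurableSet_singleton n)

theorem measureReal_ne_zero_le [IsProbabilityMeasure P] (hN : IsPoissonProcess lam N P)
    (t : ℝ≥0) : P.real {ω | N t ω ≠ 0} ≤ lam * t := by
  have h : {ω | N t ω ≠ 0} = {ω | N t ω = 0}ᶜ := rfl
  rw [h, probReal_compl_eq_one_sub (hN.measurableSet_eq t 0), hN.measureReal_eq]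
  have := Real.add_one_le_exp (-((lam : ℝ) * t))
  simp
  linarith

theorem measureReal_two_le_le [IsProbabilityMeasure P] (hN : IsPoissonProcess lam N P)
    (t : ℝ≥0) : P.real {ω | 2 ≤ N t ω} ≤ (lam * t) ^ 2 := by
  have h : {ω | 2 ≤ N t ω} = ({ω | N t ω = 0} ∪ {ω | N t ω = 1})ᶜ := by
    ext ω
    simp only [mem_ofPred_eq, mem_compl_iff, mem_union]
    omega
  rw [h, probReal_compl_eq_one_sub ((hN.measurableSet_eq t 0).union (hN.measurableSet_eq t 1)),
    measureReal_union _ (hN.measurableSet_eq t 1), hN.measureReal_eq, hN.measureReal_eq]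
  · have h1 := Real.add_one_le_exp (-((lam : ℝ) * t))
    have h2 : (0 : ℝ) ≤ lam * t := by positivity
    simp
    nlinarith
  · rw [Set.disjoint_left]
    intro ω h1 h2
    simp only [mem_ofPred_eq] at h1 h2
    omega

theorem restartAt_add_eq (hN : IsPoissonProcess lam N P) (h u : ℝ≥0) (ω : Ω) :
    N (h + u) ω = N h ω + _root_.restartAt N h u ω := eval_add_eq (hN.monotone ω) h u

end IsPoissonProcess

/-! ### Scaled probabilities and one-step inequalities. -/

section ScaledProb

variable {Ω : Type*} [MeasurableSpace Ω] {P : Measure Ω} {lam : ℝ≥0} {N : ℝ≥0 → Ω → ℕ}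

/-- The probability that the telegraph process started with velocity `v` stays below `x` up to
time `t` and reverses `n` times, multiplied by `exp (lam * t)`. -/
noncomputable def scaledProb (P : Measure Ω) (lam : ℝ≥0) (N : ℝ≥0 → Ω → ℕ) (v : ℝ) (n : ℕ)
    (t : ℝ≥0) (x : ℝ) : ℝ :=
  Real.exp (lam * t) * P.real (staysBelow v N t x ∩ {ω | N t ω = n})

theorem scaledProb_of_nonpos (v : ℝ) (n : ℕ) (t : ℝ≥0) {x : ℝ} (hx : x ≤ 0) :
    scaledProb P lam N v n t x = 0 := by
  have : staysBelow v N t x = ∅ := eq_empty_of_forall_notMem fun ω hω =>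
    (pos_of_mem_staysBelow hω).not_ge hx
  simp [scaledProb, this]

namespace IsPoissonProcess

variable [IsProbabilityMeasure P] (hN : IsPoissonProcess lam N P)
include hN

theorem scaledProb_le (v : ℝ) (n : ℕ) (t : ℝ≥0) (x : ℝ) :
    scaledProb P lam N v n t x ≤ (lam * t) ^ n / n.factorial := by
  calc scaledProb P lam N v n t x ≤ Real.exp (lam * t) * P.real {ω | N t ω = n} := by
        unfold scaledProb
        exact mul_le_mul_of_nonneg_left (measureReal_mono inter_subset_right) (Real.exp_nonneg _)
    _ = _ := by
        rw [hN.measureReal_eq, ← mul_div_assoc, ← mul_assoc, ← Real.exp_add]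
        simp

omit [IsProbabilityMeasure P] in
theorem scaledProb_of_lt {v : ℝ} (hv : |v| ≤ 1) (n : ℕ) {t : ℝ≥0} {x : ℝ} (htx : t < x) :
    scaledProb P lam N v n t x = (lam * t) ^ n / n.factorial := by
  have : staysBelow v N t x = univ := eq_univ_of_forall fun ω s hs => by
    have h3 := (abs_le.1 (abs_telegraph_le (V := fun _ => v) (N := N) (ω := ω) s)).2
    have h4 : |v| * s ≤ 1 * t := by gcongr
    linarith
  rw [scaledProb, this, univ_inter, hN.measureReal_eq, ← mul_div_assoc, ← mul_assoc,
    ← Real.exp_add]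
  simp

/-- The factor `exp (lam * h)` exactly cancels the probability of no reversal in `[0, h]`, so the
scaled probability has no decay term along characteristics. -/
theorem measureReal_eq_zero_inter (v : ℝ) (n : ℕ) (h u : ℝ≥0) (x : ℝ) :
    Real.exp (lam * (h + u)) * P.real ({ω | N h ω = 0} ∩
      (staysBelow v (_root_.restartAt N h) u x ∩ {ω | _root_.restartAt N h u ω = n})) =
      scaledProb P lam (_root_.restartAt N h) v n u x := by
  rw [hN.measureReal_inter_restartAt, hN.measureReal_eq, scaledProb, mul_add, Real.exp_add,
    Real.exp_neg]
  simp
  field_simp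

theorem measureReal_eq_one_inter (v : ℝ) (n : ℕ) (h u : ℝ≥0) (x : ℝ) :
    Real.exp (lam * (h + u)) * P.real ({ω | N h ω = 1} ∩
      (staysBelow v (_root_.restartAt N h) u x ∩ {ω | _root_.restartAt N h u ω = n})) =
      lam * h * scaledProb P lam (_root_.restartAt N h) v n u x := by
  rw [hN.measureReal_inter_restartAt, hN.measureReal_eq, scaledProb, mul_add, Real.exp_add,
    Real.exp_neg]
  simp
  field_simp

theorem scaledProb_restartAt_le {v : ℝ} (n : ℕ) (h u : ℝ≥0) {x : ℝ} (hx : 0 < x) :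
    scaledProb P lam (_root_.restartAt N h) v n u (x - v * h) ≤
      scaledProb P lam N v n (h + u) x := by
  rw [← hN.measureReal_eq_zero_inter, scaledProb, NNReal.coe_add]
  refine mul_le_mul_of_nonneg_left (measureReal_mono ?_) (Real.exp_nonneg _)
  rintro ω ⟨h0, hb, hn⟩
  refine ⟨mem_staysBelow_add_of_eq_zero (hN.monotone ω) h0 hx hb, ?_⟩
  have := hN.restartAt_add_eq h u ω
  simp only [mem_ofPred_eq] at *
  omega

theorem scaledProb_le_restartAt (v : ℝ) (n : ℕ) (h u : ℝ≥0) (x : ℝ) :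
    scaledProb P lam N v n (h + u) x ≤
      scaledProb P lam (_root_.restartAt N h) v n u (x - v * h) +
        Real.exp (lam * (h + u)) * (lam * h) := by
  rw [← hN.measureReal_eq_zero_inter, scaledProb, NNReal.coe_add, ← mul_add]
  gcongr
  refine (measureReal_mono ?_).trans ((measureReal_union_le _ _).trans
    (add_le_add le_rfl (hN.measureReal_ne_zero_le h)))
  rintro ω ⟨hb, hn⟩
  by_cases h0 : N h ω = 0
  · refine Or.inl ⟨h0, mem_staysBelow_restartAt_of_eq_zero (hN.monotone ω) h0 hb, ?_⟩
    have := hN.restartAt_add_eq h u ω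
    simp only [mem_ofPred_eq] at *
    omega
  · exact Or.inr h0

theorem scaledProb_succ_ge {v : ℝ} (hv : |v| ≤ 1) (n : ℕ) (h u : ℝ≥0) {x : ℝ} (hx : 0 < x) :
    scaledProb P lam (_root_.restartAt N h) v (n + 1) u (x - v * h) +
      lam * h * scaledProb P lam (_root_.restartAt N h) (-v) n u (x - h) ≤
      scaledProb P lam N v (n + 1) (h + u) x := by
  have hm := (hN.restartAt h)
  rw [← hN.measureReal_eq_zero_inter, ← hN.measureReal_eq_one_inter, scaledProb, NNReal.coe_add,
    ← mul_add]
  gcongr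
  rw [← measureReal_union _ ((hN.measurableSet_eq h 1).inter
    ((measurableSet_staysBelow _ hm.measurable hm.monotone hm.rightContinuous _ _).inter
      (hm.measurableSet_eq u n)))]
  · refine measureReal_mono ?_
    rintro ω (⟨h0, hb, hn⟩ | ⟨h1, hb, hn⟩) <;> have := hN.restartAt_add_eq h u ω
    · refine ⟨mem_staysBelow_add_of_eq_zero (hN.monotone ω) h0 hx hb, ?_⟩
      simp only [mem_ofPred_eq] at *
      omega
    · refine ⟨mem_staysBelow_add_of_eq_one (hN.monotone ω) h1 hv hb, ?_⟩
      simp only [mem_ofPred_eq] at *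
      omega
  · rw [Set.disjoint_left]
    rintro ω ⟨h1, -⟩ ⟨h2, -⟩
    simp only [mem_ofPred_eq] at h1 h2
    omega

theorem scaledProb_succ_le {v : ℝ} (hv : |v| ≤ 1) (n : ℕ) (h u : ℝ≥0) (x : ℝ) :
    scaledProb P lam N v (n + 1) (h + u) x ≤
    scaledProb P lam (_root_.restartAt N h) v (n + 1) u (x - v * h) +
      lam * h * scaledProb P lam (_root_.restartAt N h) (-v) n u (x + h) +
      Real.exp (lam * (h + u)) * (lam * h) ^ 2 := by
  rw [← hN.measureReal_eq_zero_inter, ← hN.measureReal_eq_one_inter, scaledProb, NNReal.coe_add,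
    ← mul_add, ← mul_add]
  gcongr
  refine (measureReal_mono ?_).trans ((measureReal_union_le _ _).trans
    (add_le_add (measureReal_union_le _ _) (hN.measureReal_two_le_le h)))
  rintro ω ⟨hb, hn⟩
  have := hN.restartAt_add_eq h u ω
  by_cases h0 : N h ω = 0
  · refine Or.inl (Or.inl ⟨h0, mem_staysBelow_restartAt_of_eq_zero (hN.monotone ω) h0 hb, ?_⟩)
    simp only [mem_ofPred_eq] at *
    omega
  by_cases h1 : N h ω = 1
  · refine Or.inl (Or.inr ⟨h1, mem_staysBelow_restartAt_of_eq_one (hN.monotone ω) h1 hv hb, ?_⟩)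
    simp only [mem_ofPred_eq] at *
    omega
  · refine Or.inr ?_
    simp only [mem_ofPred_eq]
    omega

end IsPoissonProcess

end ScaledProb

/-! ### The transport equation along characteristics and its solution. -/

theorem hasDerivWithinAt_Ici_of_squeeze {f lo hi : ℝ → ℝ} {s a : ℝ} (hlo : ContinuousAt lo s)
    (hhi : ContinuousAt hi s) (hlos : lo s = a) (hhis : hi s = a)
    (h1 : ∀ᶠ y in nhdsWithin s (Ioi s), (y - s) * lo y ≤ f y - f s)
    (h2 : ∀ᶠ y in nhdsWithin s (Ioi s), f y - f s ≤ (y - s) * hi y) :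
    HasDerivWithinAt f a (Ici s) s := by
  rw [← hasDerivWithinAt_Ioi_iff_Ici, hasDerivWithinAt_iff_tendsto_slope' self_notMem_Ioi]
  refine tendsto_of_tendsto_of_tendsto_of_le_of_le'
    (hlos ▸ hlo.tendsto.mono_left nhdsWithin_le_nhds)
    (hhis ▸ hhi.tendsto.mono_left nhdsWithin_le_nhds) ?_ ?_
  · filter_upwards [h1, self_mem_nhdsWithin] with y hy (hys : s < y)
    rw [slope_def_field, le_div_iff₀ (sub_pos.2 hys)]
    linarith
  · filter_upwards [h2, self_mem_nhdsWithin] with y hy (hys : s < y)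
    rw [slope_def_field, div_le_iff₀ (sub_pos.2 hys)]
    linarith

theorem toNNReal_sub_eq_add {t s y : ℝ} (hsy : s ≤ y) (hyt : y ≤ t) :
    (t - s).toNNReal = (y - s).toNNReal + (t - y).toNNReal := by
  rw [← Real.toNNReal_add (sub_nonneg.2 hsy) (sub_nonneg.2 hyt)]
  congr 1
  ring

section Characteristic

variable {Ω : Type*} [MeasurableSpace Ω] {P : Measure Ω} {lam : ℝ≥0} {N : ℝ≥0 → Ω → ℕ}

/-- The scaled probability along the characteristic followed before the first reversal. -/
noncomputable def scaledProbAlong (P : Measure Ω) (lam : ℝ≥0) (N : ℝ≥0 → Ω → ℕ) (v : ℝ) (n : ℕ)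
    (t x s : ℝ) : ℝ :=
  scaledProb P lam (restartAt N s.toNNReal) v n (t - s).toNNReal (x - v * s)

namespace IsPoissonProcess

variable [IsProbabilityMeasure P] (hN : IsPoissonProcess lam N P)
include hN

omit [IsProbabilityMeasure P] in
theorem restartAt_zero : _root_.restartAt N 0 = N := by
  funext s ω
  simp [_root_.restartAt, hN.zero]

omit [IsProbabilityMeasure P] in
theorem scaledProbAlong_eq (v : ℝ) (n : ℕ) (t x : ℝ) {s y : ℝ} (hs : 0 ≤ s) (hsy : s ≤ y) :
    scaledProbAlong P lam N v n t x y =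
      scaledProb P lam (_root_.restartAt (_root_.restartAt N s.toNNReal) (y - s).toNNReal) v n
        (t - y).toNNReal (x - v * s - v * (y - s).toNNReal) := by
  have h1 : _root_.restartAt (_root_.restartAt N s.toNNReal) (y - s).toNNReal =
      _root_.restartAt N y.toNNReal := by
    funext r ω
    rw [restartAt_restartAt (hN.monotone ω), ← Real.toNNReal_add hs (sub_nonneg.2 hsy)]
    simp
  rw [scaledProbAlong, h1, Real.coe_toNNReal _ (sub_nonneg.2 hsy)]
  congr 1
  ring

theorem scaledProbAlong_antitone {v : ℝ} (n : ℕ) {t x s y : ℝ} (hs : 0 ≤ s) (hsy : s ≤ y)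
    (hyt : y ≤ t) (hx : 0 < x - v * s) :
    scaledProbAlong P lam N v n t x y ≤ scaledProbAlong P lam N v n t x s := by
  rw [hN.scaledProbAlong_eq v n t x hs hsy, scaledProbAlong, toNNReal_sub_eq_add hsy hyt]
  exact (hN.restartAt _).scaledProb_restartAt_le n _ _ hx

theorem scaledProbAlong_le (v : ℝ) (n : ℕ) {t x s y : ℝ} (hs : 0 ≤ s) (hsy : s ≤ y)
    (hyt : y ≤ t) :
    scaledProbAlong P lam N v n t x s ≤
      scaledProbAlong P lam N v n t x y + Real.exp (lam * t) * lam * (y - s) := by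
  rw [hN.scaledProbAlong_eq v n t x hs hsy, scaledProbAlong, toNNReal_sub_eq_add hsy hyt]
  refine ((hN.restartAt _).scaledProb_le_restartAt v n _ _ _).trans ?_
  rw [Real.coe_toNNReal _ (sub_nonneg.2 hsy), Real.coe_toNNReal _ (sub_nonneg.2 hyt), mul_assoc]
  have : 0 ≤ y - s := sub_nonneg.2 hsy
  gcongr
  linarith

/-- The function decreases along the characteristic at a rate bounded by `exp (lam * t) * lam`,
hence is Lipschitz. Positivity of the level is left out at `S`, since for `v = 1` the level vanishes
there. -/
theorem continuousOn_scaledProbAlong {v : ℝ} (n : ℕ) {t x S : ℝ} (hS : S ≤ t)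
    (hx : ∀ s ∈ Ico 0 S, 0 < x - v * s) :
    ContinuousOn (scaledProbAlong P lam N v n t x) (Icc 0 S) := by
  have hK : 0 ≤ Real.exp (lam * t) * lam := by positivity
  have key : ∀ s ∈ Icc 0 S, ∀ y ∈ Icc 0 S, s ≤ y →
      dist (scaledProbAlong P lam N v n t x s) (scaledProbAlong P lam N v n t x y) ≤
        Real.exp (lam * t) * lam * dist s y := by
    intro s hs y hy hsy
    rcases hsy.eq_or_lt with rfl | hlt
    · simp
    · have h1 := hN.scaledProbAlong_antitone n hs.1 hsy (hy.2.trans hS)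
        (hx s ⟨hs.1, hlt.trans_le hy.2⟩)
      have h2 := hN.scaledProbAlong_le v n (x := x) hs.1 hsy (hy.2.trans hS)
      rw [Real.dist_eq, abs_of_nonneg (by linarith), dist_comm, Real.dist_eq,
        abs_of_nonneg (by linarith)]
      linarith
  refine (LipschitzOnWith.of_dist_le_mul (K := (Real.exp (lam * t) * lam).toNNReal)
    fun s hs y hy => ?_).continuousOn
  rw [Real.coe_toNNReal _ hK]
  rcases le_total s y with h | h
  · exact key s hs y hy h
  · rw [dist_comm, dist_comm s]
    exact key y hy s hs h

/-- The one-step inequalities enclose the difference quotient between two expressions continuous in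
`y` that agree at `y = s`. The inductive formula must hold for every Poisson process, because each
restart changes the process. -/
theorem hasDerivWithinAt_scaledProbAlong {v : ℝ} (hv : |v| ≤ 1) (n : ℕ) (r : ℤ)
    (ih : ∀ M : ℝ≥0 → Ω → ℕ, IsPoissonProcess lam M P → ∀ (u : ℝ≥0) (y : ℝ), 0 < y → y < u →
      scaledProb P lam M (-v) n u y =
        lam ^ n * signedDividedPowers r n ((u + y) / 2) ((u - y) / 2))
    {t x s : ℝ} (hs : 0 ≤ s) (hx : 0 < x - v * s) (hxt : x - v * s < t - s) :
    HasDerivWithinAt (scaledProbAlong P lam N v (n + 1) t x)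
      (-(lam ^ (n + 1) * signedDividedPowers r n ((t - s + (x - v * s)) / 2)
        ((t - s - (x - v * s)) / 2))) (Ici s) s := by
  have hF := signedDividedPowers.continuous r n
  let G : ℝ → ℝ → ℝ := fun y z =>
    lam ^ (n + 1) * signedDividedPowers r n ((t - y + z) / 2) ((t - y - z) / 2)
  have hG : Continuous fun y : ℝ × ℝ => G y.1 y.2 :=
    continuous_const.mul (hF.comp (by fun_prop : Continuous fun y : ℝ × ℝ =>
      ((t - y.1 + y.2) / 2, (t - y.1 - y.2) / 2)))
  have hle : ∀ᶠ y in nhdsWithin s (Ioi s), s ≤ y :=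
    eventually_nhdsWithin_of_forall fun y hy => le_of_lt hy
  have hlt : ∀ᶠ y in nhdsWithin s (Ioi s), y < t :=
    nhdsWithin_le_nhds (Iio_mem_nhds (by linarith))
  refine hasDerivWithinAt_Ici_of_squeeze
    (lo := fun y => -(G y (x - v * s + (y - s)) + Real.exp (lam * t) * lam ^ 2 * (y - s)))
    (hi := fun y => -G y (x - v * s - (y - s))) ?_ ?_ ?_ ?_ ?_ ?_
  · exact ((hG.comp (by fun_prop : Continuous fun y => (y, x - v * s + (y - s)))).add
      (by fun_prop)).neg.continuousAt
  · exact (hG.comp (by fun_prop : Continuous fun y => (y, x - v * s - (y - s)))).neg.continuousAt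
  · simp [G]
  · simp [G]
  · have hev : ∀ᶠ y in nhdsWithin s (Ioi s), x - v * s + (y - s) < t - y :=
      nhdsWithin_le_nhds (
        (by fun_prop : Continuous fun y => x - v * s + (y - s)).continuousAt.eventually_lt
        (by fun_prop : Continuous fun y => t - y).continuousAt (by simpa using hxt))
    filter_upwards [hle, hlt, hev] with y hsy hyt hy
    have hsy' := sub_nonneg.2 hsy
    have hyt' := sub_nonneg.2 hyt.le
    have := (hN.restartAt s.toNNReal).scaledProb_succ_le hv n (y - s).toNNReal (t - y).toNNReal
      (x - v * s)
    rw [← toNNReal_sub_eq_add hsy hyt.le, ← hN.scaledProbAlong_eq v _ t x hs hsy,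
      ← scaledProbAlong, ih _ ((hN.restartAt _).restartAt _) _ _ (by positivity)
      (by simpa only [Real.coe_toNNReal _ hsy', Real.coe_toNNReal _ hyt'] using hy)] at this
    simp only [Real.coe_toNNReal _ hsy', Real.coe_toNNReal _ hyt'] at this
    have he : Real.exp (lam * (y - s + (t - y))) * (lam * (y - s)) ^ 2 ≤
        Real.exp (lam * t) * (lam * (y - s)) ^ 2 := by
      gcongr
      linarith
    simp only [G, pow_succ]
    linarith
  · have hev : ∀ᶠ y in nhdsWithin s (Ioi s), x - v * s - (y - s) < t - y :=
      nhdsWithin_le_nhds (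
        (by fun_prop : Continuous fun y => x - v * s - (y - s)).continuousAt.eventually_lt
        (by fun_prop : Continuous fun y => t - y).continuousAt (by simpa using hxt))
    have hev' : ∀ᶠ y in nhdsWithin s (Ioi s), 0 < x - v * s - (y - s) :=
      nhdsWithin_le_nhds (continuousAt_const.eventually_lt
        (by fun_prop : Continuous fun y => x - v * s - (y - s)).continuousAt (by simpa using hx))
    filter_upwards [hle, hlt, hev, hev'] with y hsy hyt hy hy'
    have hsy' := sub_nonneg.2 hsy
    have hyt' := sub_nonneg.2 hyt.le
    have := (hN.restartAt s.toNNReal).scaledProb_succ_ge hv n (y - s).toNNReal (t - y).toNNReal hx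
    rw [← toNNReal_sub_eq_add hsy hyt.le, ← hN.scaledProbAlong_eq v _ t x hs hsy,
      ← scaledProbAlong, ih _ ((hN.restartAt _).restartAt _) _ _
      (by simpa only [Real.coe_toNNReal _ hsy'] using hy')
      (by simpa only [Real.coe_toNNReal _ hsy', Real.coe_toNNReal _ hyt'] using hy)] at this
    simp only [Real.coe_toNNReal _ hsy', Real.coe_toNNReal _ hyt'] at this
    simp only [G, pow_succ]
    linarith

/-- After descending for time `h` the barrier lies beyond reach in the remaining time `u = y - h`,
where the value is the full Poisson weight. Letting `u` increase to `y` gives the lower bound. -/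
theorem scaledProb_neg_one_self (n : ℕ) {y : ℝ≥0} (hy : 0 < y) :
    scaledProb P lam N (-1) n y y = (lam * y) ^ n / n.factorial := by
  refine le_antisymm (hN.scaledProb_le _ _ _ _) ?_
  have hlim : Filter.Tendsto (fun u : ℝ≥0 => (lam * u : ℝ) ^ n / n.factorial)
      (nhdsWithin y (Iio y)) (nhds ((lam * y) ^ n / n.factorial)) :=
    ((by fun_prop : Continuous fun u : ℝ≥0 =>
      (lam * u : ℝ) ^ n / n.factorial).tendsto y).mono_left nhdsWithin_le_nhds
  have : (nhdsWithin y (Iio y)).NeBot := nhdsLT_neBot_of_exists_lt ⟨0, hy⟩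
  refine le_of_tendsto hlim (eventually_nhdsWithin_of_forall fun u (hu : u < y) => ?_)
  obtain ⟨h, rfl⟩ := exists_add_of_le hu.le
  have hh : 0 < h := by simpa using hu
  rw [add_comm u h, ← (hN.restartAt h).scaledProb_of_lt (v := -1) (by simp) n
    (x := ((h + u : ℝ≥0) : ℝ) - (-1) * h)]
  · exact hN.scaledProb_restartAt_le n h u (by positivity)
  · push_cast
    have : (0 : ℝ) < h := hh
    linarith

omit [IsProbabilityMeasure P] in
theorem scaledProb_one_zero {t : ℝ≥0} {x : ℝ} (hxt : x ≤ t) :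
    scaledProb P lam N 1 0 t x = 0 := by
  have : staysBelow 1 N t x ∩ {ω | N t ω = 0} = ∅ := by
    refine eq_empty_of_forall_notMem fun ω hω => ?_
    have h1 := hω.1 t le_rfl
    rw [telegraph_of_eq_zero (hN.monotone ω) hω.2] at h1
    linarith
  simp [scaledProb, this]

omit [IsProbabilityMeasure P] in
theorem scaledProb_neg_one_zero (t : ℝ≥0) {x : ℝ} (hx : 0 < x) :
    scaledProb P lam N (-1) 0 t x = 1 := by
  have : staysBelow (-1) N t x ∩ {ω | N t ω = 0} = {ω | N t ω = 0} := by
    refine inter_eq_right.2 fun ω (hω : N t ω = 0) s hs => ?_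
    have h1 : N s ω ≤ N t ω := hN.monotone ω hs
    rw [telegraph_of_eq_zero (hN.monotone ω) (by omega)]
    have := s.coe_nonneg
    linarith
  rw [scaledProb, this, hN.measureReal_eq, Real.exp_neg]
  simp

omit hN in
theorem scaledProb_eq_signedDividedPowers (n : ℕ) :
    (∀ M : ℝ≥0 → Ω → ℕ, IsPoissonProcess lam M P → ∀ (t : ℝ≥0) (x : ℝ), 0 < x → x < t →
      scaledProb P lam M 1 n t x =
        lam ^ n * signedDividedPowers 0 n ((t + x) / 2) ((t - x) / 2)) ∧
    (∀ M : ℝ≥0 → Ω → ℕ, IsPoissonProcess lam M P → ∀ (t : ℝ≥0) (x : ℝ), 0 < x → x < t →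
      scaledProb P lam M (-1) n t x =
        lam ^ n * signedDividedPowers 1 n ((t + x) / 2) ((t - x) / 2)) := by
  induction n with
  | zero =>
    refine ⟨fun M hM t x hx hxt => ?_, fun M hM t x hx hxt => ?_⟩
    · simp [hM.scaledProb_one_zero hxt.le, signedDividedPowers.zero_index]
    · simp [hM.scaledProb_neg_one_zero t hx, signedDividedPowers.zero_index]
  | succ n ih =>
    refine ⟨fun M hM t x hx hxt => ?_, fun M hM t x hx hxt => ?_⟩
    · let cand : ℝ → ℝ := fun s =>
        lam ^ (n + 1) * signedDividedPowers 0 (n + 1) ((t + x) / 2 - s) ((t - x) / 2)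
      have hcand : ∀ s, HasDerivAt cand
          (-(lam ^ (n + 1) * signedDividedPowers 1 n ((t + x) / 2 - s) ((t - x) / 2))) s := by
        intro s
        have := ((signedDividedPowers.hasDerivAt_fst 0 n ((t + x) / 2 - s) ((t - x) / 2)).comp s
          ((hasDerivAt_id s).const_sub ((t + x) / 2))).const_mul ((lam : ℝ) ^ (n + 1))
        convert! this using 1
        simp
      have hd : ∀ s ∈ Ico 0 x, HasDerivWithinAt
          (fun s => scaledProbAlong P lam M 1 (n + 1) t x s - cand s) 0 (Ici s) s := by
        intro s hs
        have h1 := hM.hasDerivWithinAt_scaledProbAlong (v := 1) (by simp) n 1 ih.2 (t := t) (x := x)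
          hs.1 (by linarith [hs.2]) (by linarith)
        convert! h1.sub (hcand s).hasDerivWithinAt using 1
        rw [show ((t : ℝ) - s + (x - 1 * s)) / 2 = (t + x) / 2 - s by ring,
          show ((t : ℝ) - s - (x - 1 * s)) / 2 = (t - x) / 2 by ring, sub_self]
      have hc : ContinuousOn (fun s => scaledProbAlong P lam M 1 (n + 1) t x s - cand s)
          (Icc 0 x) :=
        (hM.continuousOn_scaledProbAlong (n + 1) hxt.le fun s hs => by linarith [hs.2]).sub
          fun s _ => (hcand s).continuousAt.continuousWithinAt
      have h := constant_of_has_deriv_right_zero hc hd x ⟨hx.le, le_rfl⟩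
      simp only [scaledProbAlong, cand, Real.toNNReal_zero, hM.restartAt_zero, sub_zero, mul_zero,
        Real.toNNReal_coe] at h
      rw [scaledProb_of_nonpos _ _ _ (by simp), show ((t : ℝ) + x) / 2 - x = (t - x) / 2 by ring,
        signedDividedPowers.self_eq_zero] at h
      linarith
    · let S : ℝ := (t - x) / 2
      let cand : ℝ → ℝ := fun s =>
        lam ^ (n + 1) * signedDividedPowers 1 (n + 1) ((t + x) / 2) ((t - x) / 2 - s)
      have hcand : ∀ s, HasDerivAt cand
          (-(lam ^ (n + 1) * signedDividedPowers 0 n ((t + x) / 2) ((t - x) / 2 - s))) s := by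
        intro s
        have := ((signedDividedPowers.hasDerivAt_snd 1 n ((t + x) / 2) ((t - x) / 2 - s)).comp s
          ((hasDerivAt_id s).const_sub ((t - x) / 2))).const_mul ((lam : ℝ) ^ (n + 1))
        convert! this using 1
        simp
      have hd : ∀ s ∈ Ico 0 S, HasDerivWithinAt
          (fun s => scaledProbAlong P lam M (-1) (n + 1) t x s - cand s) 0 (Ici s) s := by
        intro s hs
        have hsS : s < (t - x) / 2 := hs.2
        have h1 := hM.hasDerivWithinAt_scaledProbAlong (v := -1) (by simp) n 0
          (by simpa only [neg_neg] using ih.1) (t := t) (x := x)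
          hs.1 (by linarith [hs.1]) (by linarith)
        convert! h1.sub (hcand s).hasDerivWithinAt using 1
        rw [show ((t : ℝ) - s + (x - -1 * s)) / 2 = (t + x) / 2 by ring,
          show ((t : ℝ) - s - (x - -1 * s)) / 2 = (t - x) / 2 - s by ring, sub_self]
      have hc : ContinuousOn (fun s => scaledProbAlong P lam M (-1) (n + 1) t x s - cand s)
          (Icc 0 S) :=
        (hM.continuousOn_scaledProbAlong (n + 1) (show ((t : ℝ) - x) / 2 ≤ t by linarith)
          fun s hs => by linarith [hs.1]).sub
          fun s _ => (hcand s).continuousAt.continuousWithinAt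
      have h := constant_of_has_deriv_right_zero hc hd S
        ⟨show (0 : ℝ) ≤ (t - x) / 2 by linarith, le_rfl⟩
      have hpos : 0 < ((t : ℝ) + x) / 2 := by linarith
      have hy := (hM.restartAt S.toNNReal).scaledProb_neg_one_self (n + 1)
        (Real.toNNReal_pos.2 hpos)
      rw [Real.coe_toNNReal _ hpos.le] at hy
      simp only [scaledProbAlong, cand, Real.toNNReal_zero, hM.restartAt_zero, sub_zero, mul_zero,
        Real.toNNReal_coe] at h
      rw [show (t : ℝ) - S = (t + x) / 2 by simp only [S]; ring,
        show x - -1 * S = (t + x) / 2 by simp only [S]; ring, hy,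
        show ((t : ℝ) - x) / 2 - S = 0 by simp only [S]; ring,
        signedDividedPowers.one_right_zero, mul_pow, mul_div_assoc, sub_self] at h
      linarith

end IsPoissonProcess

end Characteristic

/-! ### Conditioning and return to speed `c`. -/

theorem mem_telegraphMax_lt_iff_mem_staysBelow {Ω : Type*} {N : ℝ≥0 → Ω → ℕ} {V : Ω → ℝ} {ω : Ω}
    (hN : Monotone fun s => N s ω) {c : ℝ} (hc : 0 < c) (hV : V ω = c) (t : ℝ≥0) (β : ℝ) :
    telegraphMax V N t ω < β ↔ ω ∈ staysBelow 1 N t (β / c) := by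
  rw [telegraphMax_lt_iff hN]
  refine forall₂_congr fun s _ => ?_
  rw [telegraph_congr (W := fun _ => c * 1) (by simpa using hV),
    telegraph_const_mul (V := fun _ => (1 : ℝ)), lt_div_iff₀ hc, mul_comm]

/-- Independence of the initial velocity cancels the factor `1 / 2`, and the Poisson weight cancels
both `lam ^ n` and the exponential, leaving `n! / t ^ n`. -/
theorem IsSymmetricTelegraph.cond_telegraphMax_lt {Ω : Type*} [MeasurableSpace Ω] {P : Measure Ω}
    [IsProbabilityMeasure P] {c : ℝ} (hc : 0 < c) {lam : ℝ≥0} (hlam : 0 < lam) {V : Ω → ℝ}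
    {N : ℝ≥0 → Ω → ℕ} (hVN : IsSymmetricTelegraph c lam V N P) {t : ℝ≥0} {β : ℝ} (hβ : 0 < β)
    (hβt : β < c * t) (n : ℕ) :
    (P[|{ω | V ω = c ∧ N t ω = n}]).real {ω | telegraphMax V N t ω < β} =
      n.factorial * signedDividedPowers 0 n ((t + β / c) / 2) ((t - β / c) / 2) / t ^ n := by
  have hN := hVN.poisson
  have hx : 0 < β / c := by positivity
  have hxt : β / c < t := by rwa [div_lt_iff₀' hc]
  have ht : (0 : ℝ) < t := hx.trans hxt
  have hlam' : (0 : ℝ) < lam := hlam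
  have hVc : MeasurableSet {ω | V ω = c} := hVN.measurable_velocity (measurableSet_singleton c)
  have hprob : P.real {ω | V ω = c} = 1 / 2 := by simp [measureReal_def, hVN.prob_pos]
  have hindep : ∀ B : Set (ℝ≥0 → ℕ), MeasurableSet B →
      P.real ({ω | V ω = c} ∩ (fun ω s => N s ω) ⁻¹' B) =
        1 / 2 * P.real ((fun ω s => N s ω) ⁻¹' B) := fun B hB => by
    rw [← hprob, measureReal_def, measureReal_def, measureReal_def, ← ENNReal.toReal_mul]
    exact congrArg ENNReal.toReal
      (hVN.indep.measure_inter_preimage_eq_mul {c} B (measurableSet_singleton c) hB)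
  have h1 : P.real {ω | V ω = c ∧ N t ω = n} = 1 / 2 * P.real {ω | N t ω = n} :=
    hindep {f | f t = n} (measurable_pi_apply (X := fun _ : ℝ≥0 => ℕ) t (measurableSet_singleton n))
  have h2 : P.real ({ω | V ω = c ∧ N t ω = n} ∩ {ω | telegraphMax V N t ω < β}) =
      1 / 2 * P.real (staysBelow 1 N t (β / c) ∩ {ω | N t ω = n}) := by
    obtain ⟨B, hB, hBe⟩ := exists_measurableSet_preimage_eq_staysBelow 1 hN.monotone
      hN.rightContinuous t (β / c) n
    rw [← hBe, ← hindep B hB, hBe]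
    congr 1
    ext ω
    simp only [mem_inter_iff, mem_ofPred_eq, and_assoc]
    refine and_congr_right fun hV => ?_
    rw [mem_telegraphMax_lt_iff_mem_staysBelow (hN.monotone ω) hc hV, and_comm]
  have h3 := (IsPoissonProcess.scaledProb_eq_signedDividedPowers (P := P) (lam := lam) n).1 N hN t
    (β / c) hx hxt
  have h4 : P.real (staysBelow 1 N t (β / c) ∩ {ω | N t ω = n}) = Real.exp (-(lam * t)) *
      (lam ^ n * signedDividedPowers 0 n ((t + β / c) / 2) ((t - β / c) / 2)) := by
    rw [← h3, scaledProb, ← mul_assoc, ← Real.exp_add]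
    simp
  have hC : MeasurableSet {ω | V ω = c ∧ N t ω = n} := hVc.inter (hN.measurableSet_eq t n)
  rw [measureReal_def, cond_apply hC, ENNReal.toReal_mul, ENNReal.toReal_inv, ← measureReal_def,
    ← measureReal_def, h1, h2, h4, hN.measureReal_eq, mul_pow]
  field_simp

theorem mainTheorem7 {Ω : Type*} [MeasurableSpace Ω] (P : Measure Ω) [IsProbabilityMeasure P]
    (c : ℝ) (hc : 0 < c) (lam : ℝ≥0) (hlam : 0 < lam) (V : Ω → ℝ) (N : ℝ≥0 → Ω → ℕ)
    (hVN : IsSymmetricTelegraph c lam V N P)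
    (t : ℝ≥0) (β : ℝ) (hβ : 0 < β) (hβt : β < c * t) (k : ℕ) :
    (P[|{ω | V ω = c ∧ N t ω = 2 * k + 2}]).real {ω | telegraphMax V N t ω < β} =
        (P[|{ω | V ω = c ∧ N t ω = 2 * k + 1}]).real {ω | telegraphMax V N t ω < β} ∧
      (P[|{ω | V ω = c ∧ N t ω = 2 * k + 1}]).real {ω | telegraphMax V N t ω < β} =
        β / (c * t) * ∑ j ∈ Finset.range (k + 1),
          ((2 * j).choose j : ℝ) * (√(c ^ 2 * t ^ 2 - β ^ 2) / (2 * c * t)) ^ (2 * j) := by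
  have ht : (0 : ℝ) < t := pos_of_mul_pos_right (hβ.trans hβt) hc.le
  have hsum : ((t : ℝ) + β / c) / 2 + (t - β / c) / 2 = t := by ring
  have hne : ((t : ℝ) + β / c) / 2 + (t - β / c) / 2 ≠ 0 := by rw [hsum]; exact ht.ne'
  rw [hVN.cond_telegraphMax_lt hc hlam hβ hβt, hVN.cond_telegraphMax_lt hc hlam hβ hβt]
  have heven := signedDividedPowers.factorial_mul_even k _ _ hne
  have hodd := signedDividedPowers.factorial_mul_odd k _ _ hne
  rw [hsum] at heven hodd
  refine ⟨heven, hodd.trans ?_⟩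
  have hsq : (0 : ℝ) ≤ c ^ 2 * t ^ 2 - β ^ 2 := by
    rw [← mul_pow, sub_nonneg]
    gcongr
  congr 1
  · field_simp
    ring
  · refine Finset.sum_congr rfl fun j _ => ?_
    rw [pow_mul, div_pow (√_), Real.sq_sqrt hsq]
    congr 2
    field_simp
    ring
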